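/- Let $(X,d)$ be a nonempty compact metric space and let $T\colon X\to X$ be continuous. Write $S_n$ for the group of permutations of $\{1,\dots,n\}$. Suppose that there exist at least two distinct $T$-invariant ergodic Borel probability measures on $X$ with full support, where $\mu$ has full support if $\mu(U)>0$ for every nonempty open set $U\subseteq X$. Then: (a) $(X,T)$ is strong mean sensitive: there is $\delta>0$ such that for every $x\in X$ and every $\varepsilon>0$ there is $y\in X$ with $d(x,y)<\varepsilon$ and $$\limsup_{n\to\infty}\ \inf_{\sigma\in S_n}\frac1n\sum_{k=1}^{n} d\bigl(T^kx,T^{\sigma(k)}y\bigr)>\delta;$$ (b) $(X,T)$ is strong sensitive in the mean: there is $\delta>0$ such that for every $x\in X$ and every $\varepsilon>0$ there are an integer $n\ge 1$ and $y\in X$ with $d(x,y)<\varepsilon$ and $$\inf_{\sigma\in S_n}\frac1n\sum_{k=1}^{n} d\bigl(T^kx,T^{\sigma(k)}y\bigr)>\delta;$$ (c) $(X,T)$ is mean sensitive: there is $\delta>0$ such that for every nonempty open set $U\subseteq X$ there are $x,y\in U$ with $$\limsup_{n\to\infty}\ \frac1n\sum_{k=1}^{n} d\bigl(T^kx,T^ky\bigr)>\delta.$$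 -/

import Mathlib

open Filter MeasureTheory

noncomputable section

namespace MeanSensitivity

variable {X : Type*} [MetricSpace X]

/-- `inf_{σ ∈ S_n} (1/n) ∑_{k=1}^{n} d(T^k x, T^{σ(k)} y)`, where `k ∈ {1, …, n}` is written as
`k + 1` with `k : Fin n`. -/
def permMean (T : X → X) (n : ℕ) (x y : X) : ℝ :=
  ⨅ σ : Equiv.Perm (Fin n),
    (1 / (n : ℝ)) * ∑ k : Fin n, dist (T^[(k : ℕ) + 1] x) (T^[(σ k : ℕ) + 1] y)

/-- `(1/n) ∑_{k=1}^{n} d(T^k x, T^k y)`. -/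
def birkhoffMean (T : X → X) (n : ℕ) (x y : X) : ℝ :=
  (1 / (n : ℝ)) * ∑ k ∈ Finset.Icc 1 n, dist (T^[k] x) (T^[k] y)

/-- The `limsup` is that of a bounded real sequence when `X` is compact. -/
def StrongMeanSensitive (T : X → X) : Prop :=
  ∃ δ : ℝ, 0 < δ ∧ ∀ x : X, ∀ ε : ℝ, 0 < ε →
    ∃ y ∈ Metric.ball x ε, δ < limsup (fun n : ℕ => permMean T n x y) atTop

def StrongSensitiveInTheMean (T : X → X) : Prop :=
  ∃ δ : ℝ, 0 < δ ∧ ∀ x : X, ∀ ε : ℝ, 0 < ε →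
    ∃ n : ℕ, 1 ≤ n ∧ ∃ y ∈ Metric.ball x ε, δ < permMean T n x y

def MeanSensitive (T : X → X) : Prop :=
  ∃ δ : ℝ, 0 < δ ∧ ∀ U : Set X, IsOpen U → U.Nonempty →
    ∃ x ∈ U, ∃ y ∈ U, δ < limsup (fun n : ℕ => birkhoffMean T n x y) atTop

end MeanSensitivity

end

/-!
Two distinct Borel probability measures `μ ≠ ν` integrate some bounded Lipschitz function `f`
differently (`exists_lipschitzWith_integral_ne`): thickened indicators of closed sets are Lipschitz.
The average of `f` over `T x, …, T^n x` does not depend on the order of the times, so a Lipschitz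
constant of `f` times `permMean T n x y` dominates the difference of the averages of `f` along the
orbits of `x` and `y` (`MeanSensitivity.abs_birkhoffAverage_sub_le_mul_permMean`).

By von Neumann's ergodic theorem (`tendstoInMeasure_birkhoffAverage_of_ergodic`) the averages of `f`
converge in measure to `∫ f ∂μ` for `μ` and to `∫ f ∂ν` for `ν`. Hence along one common subsequence
of times they converge almost everywhere for both measures; since only a limsup over times has to
be bounded below, the pointwise ergodic theorem is not needed. Full support puts points of either
kind into every ball around a given point `x`. Infinitely often the averages of `x` are far from
`∫ f ∂μ` or infinitely often far from `∫ f ∂ν`, and a nearby point of the corresponding kind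
witnesses strong mean sensitivity (`MeanSensitivity.strongMeanSensitive_of_integral_ne`). The other
two properties follow from this one, since `permMean ≤ birkhoffMean`.
-/

open Filter MeasureTheory Topology

/-! ### Ergodic averages -/

/-- Averages of the orbit of `g` under the Koopman operator on `L²` are classes of Birkhoff
averages of `g`. -/
theorem koopman_birkhoffAverage_ae_eq {α : Type*} [MeasurableSpace α] {μ : Measure α} {T : α → α}
    (hT : MeasurePreserving T μ μ) {g : α → ℝ} (hg : MemLp g 2 μ) (n : ℕ) :
    (birkhoffAverage ℝ (Lp.compMeasurePreservingₗᵢ ℝ T hT) _root_.id n (hg.toLp g) : Lp ℝ 2 μ)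
      =ᵐ[μ] birkhoffAverage ℝ T g n := by
  have hk (k : ℕ) : (Lp.compMeasurePreservingₗᵢ ℝ T hT)^[k] (hg.toLp g)
      = (hg.comp_measurePreserving (hT.iterate k)).toLp _ := by
    rw [← Lp.toLp_compMeasurePreserving hg (hT.iterate k), ← Lp.compMeasurePreserving_iterate]
    rfl
  simp only [birkhoffAverage, birkhoffSum, _root_.id, hk]
  refine (Lp.coeFn_smul _ _).trans ?_
  have hsum : (↑(∑ k ∈ Finset.range n, (hg.comp_measurePreserving (hT.iterate k)).toLp _) : α → ℝ)
      =ᵐ[μ] fun x ↦ ∑ k ∈ Finset.range n, g (T^[k] x) := by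
    induction n with
    | zero => exact Lp.coeFn_zero ℝ 2 μ
    | succ n ih =>
      simp only [Finset.sum_range_succ]
      filter_upwards [Lp.coeFn_add (∑ k ∈ Finset.range n,
          (hg.comp_measurePreserving (hT.iterate k)).toLp _)
          ((hg.comp_measurePreserving (hT.iterate n)).toLp _), ih,
        (hg.comp_measurePreserving (hT.iterate n)).coeFn_toLp] with x h₁ h₂ h₃
      rw [h₁, Pi.add_apply, h₂, h₃, Function.comp_apply]
  filter_upwards [hsum] with x hx
  rw [Pi.smul_apply, hx]
  rfl

/-- **Von Neumann's ergodic theorem** for ergodic maps: the limit of the averages of the Koopman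
operator is a constant by ergodicity, and pairing with the constant `1` identifies it as the
integral. -/
theorem tendstoInMeasure_birkhoffAverage_of_ergodic {α : Type*} [MeasurableSpace α]
    {μ : Measure α} [IsProbabilityMeasure μ] {T : α → α} (hT : Ergodic T μ) {g : α → ℝ}
    (hg : MemLp g 2 μ) :
    TendstoInMeasure μ (birkhoffAverage ℝ T g) atTop fun _ ↦ ∫ x, g x ∂μ := by
  set K := (Lp.compMeasurePreservingₗᵢ (p := 2) ℝ T hT.toMeasurePreserving :
    Lp ℝ 2 μ →ₗᵢ[ℝ] Lp ℝ 2 μ) with hK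
  set S := K.toContinuousLinearMap.eqLocus (1 : Lp ℝ 2 μ →L[ℝ] Lp ℝ 2 μ) with hS
  have hlim := ContinuousLinearMap.tendsto_birkhoffAverage_orthogonalProjection
    K.toContinuousLinearMap K.norm_toContinuousLinearMap_le (hg.toLp g)
  set P : S := S.orthogonalProjectionOnto (hg.toLp g) with hP
  have hfix : (P : Lp ℝ 2 μ) ∘ T =ᵐ[μ] (P : Lp ℝ 2 μ) := by
    have h : Lp.compMeasurePreserving T hT.toMeasurePreserving (P : Lp ℝ 2 μ) = P := P.2
    have h' := Lp.coeFn_compMeasurePreserving (P : Lp ℝ 2 μ) hT.toMeasurePreserving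
    rw [h] at h'
    exact h'.symm
  obtain ⟨c, hc⟩ := hT.ae_eq_const_of_ae_eq_comp_ae (Lp.aestronglyMeasurable _) hfix
  have hone : MemLp (fun _ : α ↦ (1 : ℝ)) 2 μ := memLp_const 1
  have hone_mem : hone.toLp _ ∈ S := by
    change Lp.compMeasurePreserving T hT.toMeasurePreserving (hone.toLp _) = hone.toLp _
    rw [Lp.toLp_compMeasurePreserving]
    rfl
  have hpair := Submodule.inner_orthogonalProjectionOnto_eq_of_mem_right
    (K := S) ⟨_, hone_mem⟩ (hg.toLp g)
  have hc_eq : c = ∫ x, g x ∂μ := by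
    rw [← hP, Submodule.coe_inner, L2.inner_def, L2.inner_def] at hpair
    have h₁ : ∫ x, inner ℝ ((P : Lp ℝ 2 μ) x) ((hone.toLp _ : Lp ℝ 2 μ) x) ∂μ = c := by
      rw [integral_congr_ae (g := fun _ ↦ c)]
      · simp
      · filter_upwards [hc] with x h₁
        simp [h₁]
    have h₂ : ∫ x, inner ℝ ((hg.toLp g : Lp ℝ 2 μ) x) ((hone.toLp _ : Lp ℝ 2 μ) x) ∂μ
        = ∫ x, g x ∂μ := by
      refine integral_congr_ae ?_
      filter_upwards [hg.coeFn_toLp] with x h₁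
      simp [h₁]
    exact h₁.symm.trans (hpair.trans h₂)
  refine (tendstoInMeasure_of_tendsto_Lp hlim).congr
    (fun n ↦ koopman_birkhoffAverage_ae_eq hT.toMeasurePreserving hg n) ?_
  rw [← hc_eq]
  exact hc

/-! ### Lipschitz functions separating measures -/

/-- Finite Borel measures are determined by the integrals of bounded Lipschitz functions, because
the measure of a closed set is the limit of the integrals of its thickened indicators. -/
theorem exists_lipschitzWith_integral_ne {X : Type*} [PseudoMetricSpace X] [MeasurableSpace X]
    [BorelSpace X] {μ ν : Measure X} [IsFiniteMeasure μ] [IsFiniteMeasure ν] (h : μ ≠ ν) :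
    ∃ (C : NNReal) (f : X → ℝ), LipschitzWith C f ∧ (∀ x, ‖f x‖ ≤ 1) ∧
      ∫ x, f x ∂μ ≠ ∫ x, f x ∂ν := by
  contrapose! h
  have key (F : Set X) (hF : IsClosed F) : μ F = ν F := by
    have hpos (n : ℕ) : (0 : ℝ) < 1 / (n + 1) := Nat.one_div_pos_of_nat
    have hμ := tendsto_lintegral_thickenedIndicator_of_isClosed μ hF hpos
      tendsto_one_div_add_atTop_nhds_zero_nat
    have hν := tendsto_lintegral_thickenedIndicator_of_isClosed ν hF hpos
      tendsto_one_div_add_atTop_nhds_zero_nat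
    refine tendsto_nhds_unique hμ (hν.congr fun n ↦ ?_)
    have := h _ (fun x ↦ (thickenedIndicator (hpos n) F x : ℝ))
      (NNReal.isometry_coe.lipschitz.comp (lipschitzWith_thickenedIndicator (hpos n) F))
      (fun x ↦ by simpa using thickenedIndicator_le_one (hpos n) F x)
    rw [← BoundedContinuousFunction.toReal_lintegral_coe_eq_integral,
      ← BoundedContinuousFunction.toReal_lintegral_coe_eq_integral] at this
    exact ((ENNReal.toReal_eq_toReal_iff'
      (BoundedContinuousFunction.lintegral_lt_top_of_nnreal μ _).ne
      (BoundedContinuousFunction.lintegral_lt_top_of_nnreal ν _).ne).mp this).symm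
  refine ext_of_generate_finite _ ?_ isPiSystem_isClosed (fun F hF ↦ key F hF) (key _ isClosed_univ)
  rw [BorelSpace.measurable_eq (α := X), borel_eq_generateFrom_isClosed]

/-! ### Permuted orbit distances -/

namespace MeanSensitivity

variable {X : Type*} [MetricSpace X]

theorem permMean_le_birkhoffMean (T : X → X) (n : ℕ) (x y : X) :
    permMean T n x y ≤ birkhoffMean T n x y := by
  refine (ciInf_le (Set.finite_range _).bddBelow (1 : Equiv.Perm (Fin n))).trans_eq ?_
  have hIcc : Finset.Icc 1 n = Finset.Ico (0 + 1) (n + 1) := by ext; simp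
  rw [birkhoffMean, hIcc, ← Finset.sum_Ico_add' (fun k ↦ dist (T^[k] x) (T^[k] y)),
    ← Finset.range_eq_Ico, Finset.sum_range]
  rfl

theorem permMean_nonneg (T : X → X) (n : ℕ) (x y : X) : 0 ≤ permMean T n x y :=
  Real.iInf_nonneg fun _ ↦ by positivity

theorem birkhoffMean_le_diam [CompactSpace X] (T : X → X) (n : ℕ) (x y : X) :
    birkhoffMean T n x y ≤ Metric.diam (Set.univ : Set X) := by
  have hd (k : ℕ) : dist (T^[k] x) (T^[k] y) ≤ Metric.diam (Set.univ : Set X) :=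
    Metric.dist_le_diam_of_mem isCompact_univ.isBounded trivial trivial
  have hs := Finset.sum_le_card_nsmul (Finset.Icc 1 n) _ _ fun k _ ↦ hd k
  rw [Nat.card_Icc, Nat.add_sub_cancel, nsmul_eq_mul] at hs
  rcases n.eq_zero_or_pos with rfl | hn
  · simpa [birkhoffMean] using Metric.diam_nonneg
  · rw [birkhoffMean, one_div, inv_mul_le_iff₀ (by positivity)]
    exact hs

/-- The average of `f` over `T x, …, T^n x` does not change when the times are permuted, so no
permutation can bring the orbits of `x` and `y` closer than these averages allow. -/
theorem abs_birkhoffAverage_sub_le_mul_permMean {T : X → X} {f : X → ℝ} {C : NNReal}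
    (hf : LipschitzWith C f) (n : ℕ) (x y : X) :
    |birkhoffAverage ℝ T (f ∘ T) n x - birkhoffAverage ℝ T (f ∘ T) n y|
      ≤ C * permMean T n x y := by
  rw [permMean, Real.mul_iInf_of_nonneg C.coe_nonneg]
  refine le_ciInf fun σ ↦ ?_
  have havg (z : X) (τ : Equiv.Perm (Fin n)) : birkhoffAverage ℝ T (f ∘ T) n z
      = (1 / (n : ℝ)) * ∑ k : Fin n, f (T^[(τ k : ℕ) + 1] z) := by
    rw [Equiv.sum_comp τ fun k : Fin n ↦ f (T^[(k : ℕ) + 1] z)]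
    simp [birkhoffAverage, birkhoffSum, Finset.sum_range, Function.iterate_succ_apply']
  rw [havg x 1, havg y σ, ← mul_sub, ← Finset.sum_sub_distrib, abs_mul,
    abs_of_nonneg (by positivity), mul_left_comm]
  gcongr
  rw [Finset.mul_sum]
  refine (Finset.abs_sum_le_sum_abs _ _).trans (Finset.sum_le_sum fun k _ ↦ ?_)
  exact hf.dist_le_mul _ _

/-! ### Sensitivity -/

/-- A limsup exceeding `δ` forces values exceeding `δ` at arbitrarily large times. Boundedness of
`permMean` from below is what keeps the real limsup from being a default value here. -/
theorem StrongMeanSensitive.strongSensitiveInTheMean {T : X → X} (h : StrongMeanSensitive T) :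
    StrongSensitiveInTheMean T := by
  obtain ⟨δ, hδ, h⟩ := h
  refine ⟨δ, hδ, fun x ε hε ↦ ?_⟩
  obtain ⟨y, hy, hlim⟩ := h x ε hε
  have hcob : IsCoboundedUnder (· ≤ ·) atTop fun n ↦ permMean T n x y :=
    IsCoboundedUnder.of_frequently_ge (a := 0) (.of_forall fun n ↦ permMean_nonneg T n x y)
  obtain ⟨n, hn, hlt⟩ :=
    ((frequently_lt_of_lt_limsup hcob hlim).and_eventually (eventually_ge_atTop 1)).exists
  exact ⟨n, hlt, y, hy, hn⟩

theorem StrongMeanSensitive.meanSensitive [CompactSpace X] {T : X → X}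
    (h : StrongMeanSensitive T) : MeanSensitive T := by
  obtain ⟨δ, hδ, h⟩ := h
  refine ⟨δ, hδ, fun U hU ⟨x, hx⟩ ↦ ?_⟩
  obtain ⟨ε, hε, hball⟩ := Metric.isOpen_iff.1 hU x hx
  obtain ⟨y, hy, hlim⟩ := h x ε hε
  refine ⟨x, hx, y, hball hy, hlim.trans_le <| limsup_le_limsup
    (.of_forall fun n ↦ permMean_le_birkhoffMean T n x y) ?_ ?_⟩
  · exact IsCoboundedUnder.of_frequently_ge (a := 0) (.of_forall fun n ↦ permMean_nonneg T n x y)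
  · exact isBoundedUnder_of ⟨_, fun n ↦ birkhoffMean_le_diam T n x y⟩

/-- Near every point `x` there are points whose averages, along one common sequence of times, tend
to `∫ f ∂μ` and points whose averages tend to `∫ f ∂ν`; the averages of `x` cannot follow both. -/
theorem strongMeanSensitive_of_integral_ne [CompactSpace X] [MeasurableSpace X] [BorelSpace X]
    {T : X → X} {μ ν : Measure X} [IsProbabilityMeasure μ] [IsProbabilityMeasure ν]
    (hμ : Ergodic T μ) (hν : Ergodic T ν) (hμs : μ.support = Set.univ)
    (hνs : ν.support = Set.univ) {C : NNReal} {f : X → ℝ} (hf : LipschitzWith C f)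
    (hbound : ∀ x, ‖f x‖ ≤ 1) (hne : ∫ x, f x ∂μ ≠ ∫ x, f x ∂ν) : StrongMeanSensitive T := by
  have hconv (ρ : Measure X) [IsProbabilityMeasure ρ] (hρ : Ergodic T ρ) :
      TendstoInMeasure ρ (birkhoffAverage ℝ T (f ∘ T)) atTop fun _ ↦ ∫ x, f x ∂ρ := by
    have hmem : MemLp f 2 ρ :=
      .of_bound hf.continuous.aestronglyMeasurable 1 (ae_of_all _ hbound)
    have h := tendstoInMeasure_birkhoffAverage_of_ergodic hρ
      (hmem.comp_measurePreserving hρ.toMeasurePreserving)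
    have hint : ∫ x, (f ∘ T) x ∂ρ = ∫ x, f x ∂ρ := by
      conv_rhs => rw [← hρ.toMeasurePreserving.map_eq]
      exact (integral_map hρ.measurable.aemeasurable
        hf.continuous.aestronglyMeasurable).symm
    rwa [hint] at h
  obtain ⟨ns, hns, hae⟩ := (hconv μ hμ).exists_seq_tendsto_ae
  obtain ⟨ms, hms, hae'⟩ :=
    TendstoInMeasure.exists_seq_tendsto_ae ((hconv ν hν).comp hns.tendsto_atTop)
  have hexists {ρ : Measure X} (hρ : ρ.support = Set.univ) {p : X → Prop} (hp : ∀ᵐ z ∂ρ, p z)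
      (x : X) {ε : ℝ} (hε : 0 < ε) : ∃ y ∈ Metric.ball x ε, p y := by
    have hpos := (Measure.mem_support_iff_forall x).1 (hρ ▸ Set.mem_univ x) _
      (Metric.ball_mem_nhds x hε)
    exact ((frequently_ae_mem_iff.2 hpos.ne').and_eventually hp).exists
  set a := ∫ x, f x ∂μ
  set b := ∫ x, f x ∂ν
  set c := |a - b|
  have hc : 0 < c := abs_pos.2 (sub_ne_zero.2 hne)
  -- `C + 1` is used in place of `C`, which may vanish.
  have hC : (0 : ℝ) < C + 1 := by positivity
  refine ⟨c / (8 * (C + 1)), by positivity, fun x ε hε ↦ ?_⟩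
  have hlimsup {y : X} (hy : ∃ᶠ n in atTop,
      c / 4 ≤ |birkhoffAverage ℝ T (f ∘ T) n x - birkhoffAverage ℝ T (f ∘ T) n y|) :
      c / (8 * (C + 1)) < limsup (fun n ↦ permMean T n x y) atTop := by
    have hlt : c / (8 * (C + 1)) < c / (4 * (C + 1)) := by gcongr; norm_num
    refine hlt.trans_le (le_limsup_of_frequently_le (hy.mono fun n hn ↦ ?_) (isBoundedUnder_of
      ⟨_, fun n ↦ (permMean_le_birkhoffMean T n x y).trans (birkhoffMean_le_diam T n x y)⟩))
    have h₁ := abs_birkhoffAverage_sub_le_mul_permMean (T := T) hf n x y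
    have h₂ := permMean_nonneg T n x y
    rw [div_le_iff₀ (by positivity)]
    linarith
  obtain ⟨y, hy, hya⟩ := hexists hμs hae x hε
  obtain ⟨z, hz, hzb⟩ := hexists hνs hae' x hε
  have hya' := (hya.comp hms.tendsto_atTop).eventually (Metric.ball_mem_nhds a (ε := c / 4)
    (by positivity))
  have hzb' := hzb.eventually (Metric.ball_mem_nhds b (ε := c / 4) (by positivity))
  have hfreq : ∃ᶠ n in atTop,
      c / 4 ≤ |birkhoffAverage ℝ T (f ∘ T) n x - birkhoffAverage ℝ T (f ∘ T) n y| ∨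
      c / 4 ≤ |birkhoffAverage ℝ T (f ∘ T) n x - birkhoffAverage ℝ T (f ∘ T) n z| := by
    refine (hns.tendsto_atTop.comp hms.tendsto_atTop).frequently (Eventually.frequently ?_)
    filter_upwards [hya', hzb'] with i h₁ h₂
    simp only [Function.comp_apply, Real.dist_eq] at h₁ h₂ ⊢
    by_contra! hcon
    obtain ⟨h₃, h₄⟩ := hcon
    refine lt_irrefl c ?_
    -- Otherwise `a` and `b` are both within `c / 2` of the average of `x`, so `|a - b| < c`.
    rw [abs_lt] at h₁ h₂ h₃ h₄
    exact abs_lt.2 ⟨by linarith, by linarith⟩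
  rcases frequently_or_distrib.1 hfreq with h | h
  · exact ⟨y, hy, hlimsup h⟩
  · exact ⟨z, hz, hlimsup h⟩

end MeanSensitivity

theorem theorem5p10 {X : Type*} [MetricSpace X] [CompactSpace X] [MeasurableSpace X]
    [BorelSpace X] (T : X → X) (hT : Continuous T)
    (hE : ∃ μ ν : Measure X, IsProbabilityMeasure μ ∧ IsProbabilityMeasure ν ∧
      Ergodic T μ ∧ Ergodic T ν ∧ μ.support = Set.univ ∧ ν.support = Set.univ ∧ μ ≠ ν) :
    MeanSensitivity.StrongMeanSensitive T ∧
      MeanSensitivity.StrongSensitiveInTheMean T ∧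
      MeanSensitivity.MeanSensitive T := by

  obtain ⟨μ, ν, _, _, hμ, hν, hμs, hνs, hne⟩ := hE
  obtain ⟨C, f, hf, hbound, hint⟩ := exists_lipschitzWith_integral_ne hne
  have h := MeanSensitivity.strongMeanSensitive_of_integral_ne hμ hν hμs hνs hf hbound hint
  exact ⟨h, h.strongSensitiveInTheMean, h.meanSensitive⟩
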